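/- **Theorem 14.1 (generalized Mason inequality).** Let $M$ be a matroid of rank $r$ on a finite ground set $X$ with $|X| = n$. Let $k \ge 0$, let $S_1,\dots,S_k \subseteq X$ be pairwise disjoint, let $c_1,\dots,c_k$ be integers with $0 \le c_i \le r$, and put $R := X \smallsetminus \bigcup_i S_i$ and $m := n - c_1 - \dots - c_k$. For an integer $a \ge 0$, let $\mathrm{I}_{S,c}(M,a)$ be the number of independent sets $A$ of $M$ such that $|A \cap R| = a$ and $|A \cap S_i| = c_i$ for all $1 \le i \le k$. Then for every integer $a$ with $1 \le a \le \min\{r-1,\,m-1\}$, $$\mathrm{I}_{S,c}(M,a)^2 \;\ge\; \Bigl(1+\frac1a\Bigr)\Bigl(1+\frac1{m-a}\Bigr)\,\mathrm{I}_{S,c}(M,a+1)\,\mathrm{I}_{S,c}(M,a-1).$$ -/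

import Mathlib

/-- `indepFamily M S c a` is the collection `𝓘_{S,c}(M, a)` of independent sets `A` of `M` such that
`|A ∩ R| = a`, where `R` is the complement of `⋃ i, S i` in the ground set of `M`, and
`|A ∩ S i| = c i` for all `i`. -/
def indepFamily {α : Type*} {k : ℕ} (M : Matroid α) (S : Fin k → Set α) (c : Fin k → ℕ) (a : ℕ) :
    Set (Set α) :=
  {A | M.Indep A ∧ (A ∩ (M.E \ ⋃ i, S i)).ncard = a ∧ ∀ i, (A ∩ S i).ncard = c i}

/-- `indepCount M S c a` is the number `I_{S,c}(M, a)` of these independent sets. -/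
noncomputable def indepCount {α : Type*} {k : ℕ} (M : Matroid α) (S : Fin k → Set α)
    (c : Fin k → ℕ) (a : ℕ) : ℕ :=
  (indepFamily M S c a).ncard

/-- For a matroid on a finite ground set the collection is finite, so that the cardinality
is the true one. -/
theorem indepFamily_finite {α : Type*} {k : ℕ} (M : Matroid α) [M.Finite] (S : Fin k → Set α)
    (c : Fin k → ℕ) (a : ℕ) : (indepFamily M S c a).Finite :=
  M.ground_finite.finite_subsets.subset fun _ hA => hA.1.subset_ground

/-! Let `n` be the size of the ground set. The homogenized independence polynomial `f = ∑ w ^ A * t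
^ (n - #A)`, over independent `A`, is Lorentzian, so its mixed derivatives in nonnegative directions
satisfy an Alexandrov-Fenchel inequality (`dirDeriv_mul_le_sq`). Differentiate `c i` times along the
indicator of `S i` and `a - 1` times along the indicator of `R`, then apply the inequality to the
two directions "indicator of `R`" and `t`. The three derivatives that occur are the three counts
times factorials (`colorDeriv_indepWeight`), and the factorials produce exactly the constants of
Mason's inequality.

The Lorentzian property is proved by induction on the number of derivatives. At the base
(`hessian_indepWeight_isLorentzian`) the quadratic form depends only on the parallel classes of the
contraction by an independent set `A`, and Cauchy-Schwarz over these classes suffices. In the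
inductive step the Hessian of a derivative is a positive combination of Lorentzian slices of a
symmetric tensor. Summing the slice inequalities gives `λ ≤ λ ^ 2` for the eigenvalues of the
normalized Hessian; a Perron-Frobenius argument then leaves at most one positive eigenvalue. -/

open Matrix in
/-- A real square matrix is Lorentzian if its quadratic form satisfies the reversed
Cauchy-Schwarz inequality against nonnegative vectors. -/
def Matrix.IsLorentzian {ι : Type*} [Fintype ι] (H : Matrix ι ι ℝ) : Prop :=
  ∀ x y : ι → ℝ, (∀ i, 0 ≤ y i) → (x ⬝ᵥ H *ᵥ x) * (y ⬝ᵥ H *ᵥ y) ≤ (x ⬝ᵥ H *ᵥ y) ^ 2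

/-! ### Lorentzian matrices and the Bochner method. -/

namespace Matrix

variable {ι : Type*} [Fintype ι]

theorem isLorentzian_zero : (0 : Matrix ι ι ℝ).IsLorentzian := by
  intro x y _
  simp

theorem IsSymm.dotProduct_mulVec_comm {H : Matrix ι ι ℝ} (hH : H.IsSymm) (x y : ι → ℝ) :
    x ⬝ᵥ H *ᵥ y = y ⬝ᵥ H *ᵥ x := by
  rw [dotProduct_mulVec, ← mulVec_transpose, hH.eq, dotProduct_comm]

theorem dotProduct_mulVec_nonneg {H : Matrix ι ι ℝ} (h0 : ∀ i j, 0 ≤ H i j) {x y : ι → ℝ}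
    (hx : ∀ i, 0 ≤ x i) (hy : ∀ i, 0 ≤ y i) : 0 ≤ x ⬝ᵥ H *ᵥ y :=
  Finset.sum_nonneg fun i _ => mul_nonneg (hx i)
    (Finset.sum_nonneg fun j _ => mul_nonneg (h0 i j) (hy j))

/-- The combination of `x` and `y` that is `H`-orthogonal to `w` has nonpositive form; multiplying
by the form of `y` and completing the square gives the reversed Cauchy-Schwarz inequality. -/
theorem isLorentzian_of_orthogonal_nonpos {H : Matrix ι ι ℝ} (hH : H.IsSymm)
    (h0 : ∀ i j, 0 ≤ H i j) (w : ι → ℝ)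
    (hneg : ∀ x, x ⬝ᵥ H *ᵥ w = 0 → x ⬝ᵥ H *ᵥ x ≤ 0) : H.IsLorentzian := by
  intro x y hy
  have hY := dotProduct_mulVec_nonneg h0 hy hy
  have hβ : y ⬝ᵥ H *ᵥ w = 0 → y ⬝ᵥ H *ᵥ y ≤ 0 := hneg y
  have hyx := hH.dotProduct_mulVec_comm y x
  have key := hneg ((y ⬝ᵥ H *ᵥ w) • x - (x ⬝ᵥ H *ᵥ w) • y) (by
    simp only [sub_dotProduct, smul_dotProduct, smul_eq_mul]; ring)
  simp only [sub_dotProduct, smul_dotProduct, smul_eq_mul, mulVec_sub, mulVec_smul,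
    dotProduct_sub, dotProduct_smul, hyx] at key
  generalize x ⬝ᵥ H *ᵥ x = X at *
  generalize y ⬝ᵥ H *ᵥ y = Y at *
  generalize x ⬝ᵥ H *ᵥ y = Z at *
  generalize x ⬝ᵥ H *ᵥ w = α at *
  generalize y ⬝ᵥ H *ᵥ w = β at *
  rcases hY.eq_or_lt with hY | hY
  · rw [← hY]; nlinarith [sq_nonneg Z]
  · by_contra! hlt
    have hβ0 : β ≠ 0 := fun h => absurd (hβ h) (not_le.2 hY)
    have h1 : 0 < β ^ 2 * (X * Y - Z ^ 2) := mul_pos (by positivity) (by linarith)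
    nlinarith [sq_nonneg (α * Y - β * Z)]

/-- The right side is the Dirichlet energy of `x / w` on the graph weighted by `H`. For nonnegative
`H` it bounds the normalized eigenvalues by 1, with equality only if `x / w` is constant along
edges. -/
theorem sum_sub_dotProduct_mulVec_eq_laplacian {H : Matrix ι ι ℝ} (hH : H.IsSymm)
    {w : ι → ℝ} (hw : ∀ i, 0 < w i) (x : ι → ℝ) :
    ∑ i, (H *ᵥ w) i / w i * x i ^ 2 - x ⬝ᵥ H *ᵥ x =
      (∑ i, ∑ j, H i j * (w i * w j) * (x i / w i - x j / w j) ^ 2) / 2 := by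
  have e1 : ∑ i, (H *ᵥ w) i / w i * x i ^ 2 = ∑ i, ∑ j, H i j * w j / w i * x i ^ 2 := by
    refine Finset.sum_congr rfl fun i _ => ?_
    rw [mulVec, dotProduct, Finset.sum_div, Finset.sum_mul]
  have e2 : ∑ i, (H *ᵥ w) i / w i * x i ^ 2 = ∑ i, ∑ j, H i j * w i / w j * x j ^ 2 := by
    rw [e1, Finset.sum_comm]
    exact Finset.sum_congr rfl fun i _ => Finset.sum_congr rfl fun j _ => by
      rw [hH.apply]
  have e3 : x ⬝ᵥ H *ᵥ x = ∑ i, ∑ j, H i j * x i * x j := by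
    refine Finset.sum_congr rfl fun i _ => ?_
    rw [mulVec, dotProduct, Finset.mul_sum]
    exact Finset.sum_congr rfl fun j _ => by ring
  rw [eq_div_iff two_ne_zero, sub_mul, mul_two, mul_two]
  nth_rw 1 [e1]
  rw [e2, e3]
  simp only [← Finset.sum_add_distrib, ← Finset.sum_sub_distrib]
  refine Finset.sum_congr rfl fun i _ => Finset.sum_congr rfl fun j _ => ?_
  have := (hw i).ne'
  have := (hw j).ne'
  field_simp
  ring

/-- The Bochner method: an inequality between `H` and its square, together with connectedness of
the graph of `H` through `i₀`, forces `H` to have at most one positive eigenvalue. -/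
theorem nonpos_of_bochner {H : Matrix ι ι ℝ} (hH : H.IsSymm) (h0 : ∀ i j, 0 ≤ H i j)
    {w : ι → ℝ} (hw : ∀ i, 0 < w i) (i₀ : ι) (hstar : ∀ i, H i i₀ = 0 → ∀ j, H i j = 0)
    (hB : ∀ x, x ⬝ᵥ H *ᵥ x ≤ ∑ i, w i * ((H *ᵥ x) i ^ 2 / (H *ᵥ w) i))
    (x : ι → ℝ) (hx : x ⬝ᵥ H *ᵥ w = 0) : x ⬝ᵥ H *ᵥ x ≤ 0 := by
  classical
  set d : ι → ℝ := fun i => (H *ᵥ w) i / w i with hd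
  have hHw : ∀ i, 0 ≤ (H *ᵥ w) i := fun i =>
    Finset.sum_nonneg fun j _ => mul_nonneg (h0 i j) (hw j).le
  have hd0 : ∀ i, 0 ≤ d i := fun i => div_nonneg (hHw i) (hw i).le
  have hdH : ∀ i, d i = 0 → ∀ j, H i j = 0 := by
    intro i hi j
    have h1 : (H *ᵥ w) i = 0 := by
      rcases div_eq_zero_iff.1 hi with h | h
      · exact h
      · exact absurd h (hw i).ne'
    have h2 := (Finset.sum_eq_zero_iff_of_nonneg
      (fun j _ => mul_nonneg (h0 i j) (hw j).le)).1 h1 j (Finset.mem_univ j)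
    exact (mul_eq_zero.1 h2).resolve_right (hw j).ne'
  set s : ι → ℝ := fun i => √(d i) with hs
  have hss : ∀ i, s i ^ 2 = d i := fun i => Real.sq_sqrt (hd0 i)
  have hs0 : ∀ i, s i = 0 → ∀ j, H i j = 0 := fun i hi =>
    hdH i (by rw [← hss, hi]; simp)
  -- Normalization making `s * w` an eigenvector of eigenvalue 1. Division by zero is harmless: `s i
  -- = 0` forces row `i` of `H` to vanish.
  set A : Matrix ι ι ℝ := Matrix.of fun i j => H i j / (s i * s j) with hA
  have hAH : A.IsHermitian := by
    ext i j
    simp [hA, hH.apply i j, mul_comm]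
  have hAs : ∀ i j, s i * A i j * s j = H i j := by
    intro i j
    by_cases hi : s i = 0
    · rw [hs0 i hi]; simp [hi]
    by_cases hj : s j = 0
    · rw [← hH.apply, hs0 j hj]; simp [hj]
    simp only [hA, of_apply]
    field_simp
  set b := hAH.eigenvectorBasis
  set z : EuclideanSpace ℝ ι := WithLp.toLp 2 fun i => s i * x i with hz
  have hzA : x ⬝ᵥ H *ᵥ x = inner ℝ z (WithLp.toLp 2 (A *ᵥ z.ofLp)) := by
    simp only [PiLp.inner_apply, dotProduct, mulVec, hz, ← hAs, RCLike.inner_apply, conj_trivial,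
      Finset.mul_sum, Finset.sum_mul]
    refine Finset.sum_congr rfl fun i _ => Finset.sum_congr rfl fun j _ => ?_
    ring
  have hAsym : ∀ y : EuclideanSpace ℝ ι, ∀ j,
      inner ℝ (b j) (WithLp.toLp 2 (A *ᵥ y.ofLp)) = hAH.eigenvalues j * inner ℝ (b j) y := by
    intro y j
    have h1 := hAH.mulVec_eigenvectorBasis j
    have h2 : (b j).ofLp ⬝ᵥ A *ᵥ y.ofLp = y.ofLp ⬝ᵥ A *ᵥ (b j).ofLp :=
      IsSymm.dotProduct_mulVec_comm
      (by rw [IsSymm, ← conjTranspose_eq_transpose_of_trivial]; exact hAH) _ _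
    rw [h1] at h2
    simp only [dotProduct, PiLp.inner_apply, RCLike.inner_apply, conj_trivial] at h2 ⊢
    rw [Finset.mul_sum]
    refine Eq.trans ?_ (h2.trans ?_)
    · exact Finset.sum_congr rfl fun i _ => by ring
    · refine Finset.sum_congr rfl fun i _ => ?_
      simp only [Pi.smul_apply, smul_eq_mul]
      ring_nf
      rfl
  -- In an eigenbasis the form is `∑ λ_j ⟨z, b_j⟩ ^ 2`, so it suffices that `z` is orthogonal to
  -- every eigenvector with positive eigenvalue.
  rw [hzA, ← b.sum_inner_mul_inner]
  refine Finset.sum_nonpos fun j _ => ?_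
  rw [hAsym, real_inner_comm]
  set l := hAH.eigenvalues j with hl
  have hgoal : ∀ t : ℝ, (l ≤ 0 ∨ t = 0) → t * (l * t) ≤ 0 := by
    rintro t (h | h)
    · nlinarith [sq_nonneg t]
    · simp [h]
  apply hgoal
  by_contra! hcon
  obtain ⟨hlpos, hzj⟩ := hcon
  apply hzj
  have hAv : A *ᵥ (b j).ofLp = l • (b j).ofLp := hAH.mulVec_eigenvectorBasis j
  set v : ι → ℝ := (b j).ofLp with hv
  have hvn : ∑ i, v i ^ 2 = 1 := by
    have h1 := b.orthonormal.1 j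
    rw [EuclideanSpace.norm_eq, Real.sqrt_eq_one] at h1
    simpa using h1
  have hvs : ∀ i, s i = 0 → v i = 0 := by
    intro i hi
    have h1 := congrFun hAv i
    simp only [mulVec, dotProduct, hA, of_apply, hi, zero_mul, div_zero, Finset.sum_const_zero,
      Pi.smul_apply, smul_eq_mul] at h1
    rcases mul_eq_zero.1 h1.symm with h | h
    · exact absurd h hlpos.ne'
    · exact h
  set y : ι → ℝ := fun i => v i / s i with hy
  have hsy : ∀ i, s i * y i = v i := by
    intro i
    by_cases hi : s i = 0
    · rw [hvs i hi, hi, zero_mul]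
    · simp only [hy]; field_simp
  have hHy : ∀ i, (H *ᵥ y) i = s i * (l * v i) := by
    intro i
    have h1 := congrFun hAv i
    simp only [Pi.smul_apply, smul_eq_mul] at h1
    rw [← h1, mulVec, mulVec, dotProduct, dotProduct, Finset.mul_sum]
    refine Finset.sum_congr rfl fun k _ => ?_
    rw [← hAs, ← hsy]; ring
  have hQ : y ⬝ᵥ H *ᵥ y = l := by
    rw [dotProduct]
    simp_rw [hHy]
    calc ∑ i, y i * (s i * (l * v i)) = ∑ i, l * v i ^ 2 :=
          Finset.sum_congr rfl fun i _ => by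
            rw [sq]; nth_rw 2 [← hsy i]; ring
      _ = l := by rw [← Finset.mul_sum, hvn, mul_one]
  -- The Bochner inequality at the rescaled eigenvector `y`; since `l > 0`, this means `l ≥ 1`.
  have hge : l ≤ l ^ 2 := by
    have h1 := hB y
    rw [hQ] at h1
    refine h1.trans (le_of_eq ?_)
    calc _ = ∑ i, l ^ 2 * v i ^ 2 := by
          refine Finset.sum_congr rfl fun i _ => ?_
          rw [hHy]
          have hwi := (hw i).ne'
          by_cases hi : s i = 0
          · simp [hvs i hi]
          · have h2 : (H *ᵥ w) i = s i ^ 2 * w i := by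
              rw [hss, hd]; field_simp
            rw [h2]; field_simp
      _ = l ^ 2 := by rw [← Finset.mul_sum, hvn, mul_one]
  have hlap := sum_sub_dotProduct_mulVec_eq_laplacian hH hw y
  have hD : ∑ i, (H *ᵥ w) i / w i * y i ^ 2 = 1 := by
    rw [← hvn]
    refine Finset.sum_congr rfl fun i _ => ?_
    rw [← hsy, mul_pow, hss]
  rw [hD, hQ] at hlap
  have hterm : ∀ i k, 0 ≤ H i k * (w i * w k) * (y i / w i - y k / w k) ^ 2 := fun i k =>
    mul_nonneg (mul_nonneg (h0 i k) (mul_pos (hw i) (hw k)).le) (sq_nonneg _)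
  -- The energy is `2 * (1 - l)`, nonnegative by its form and nonpositive by `l ≥ 1`.
  have hsum0 : ∑ i, ∑ k, H i k * (w i * w k) * (y i / w i - y k / w k) ^ 2 = 0 := by
    refine le_antisymm ?_ (Finset.sum_nonneg fun i _ => Finset.sum_nonneg fun k _ => hterm i k)
    have : 1 ≤ l := by nlinarith
    linarith
  have hprop : ∀ i, d i ≠ 0 → y i = y i₀ / w i₀ * w i := by
    intro i hi
    have h1 := (Finset.sum_eq_zero_iff_of_nonneg
      (fun i _ => Finset.sum_nonneg fun k _ => hterm i k)).1 hsum0 i (Finset.mem_univ i)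
    have h2 := (Finset.sum_eq_zero_iff_of_nonneg (fun k _ => hterm i k)).1 h1 i₀
      (Finset.mem_univ i₀)
    have h3 : H i i₀ ≠ 0 := fun h => hi (by
      simp [hd, mulVec, dotProduct, hstar i h])
    have h4 : H i i₀ * (w i * w i₀) ≠ 0 := mul_ne_zero h3 (mul_pos (hw i) (hw i₀)).ne'
    have h5 := pow_eq_zero_iff two_ne_zero |>.1 ((mul_eq_zero.1 h2).resolve_left h4)
    rw [← sub_eq_zero.1 h5, div_mul_cancel₀ _ (hw i).ne']
  -- So `y` is a multiple of `w` off the zero rows, and `⟨z, v⟩` is that multiple of `x ⬝ᵥ H *ᵥ w =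
  -- 0`.
  have hfin : ∀ i, s i * x i * v i = y i₀ / w i₀ * (x i * (H *ᵥ w) i) := by
    intro i
    have h2 : (H *ᵥ w) i = d i * w i := by
      rw [hd]; exact (div_mul_cancel₀ _ (hw i).ne').symm
    by_cases hi : d i = 0
    · rw [h2, hi]
      simp [hs, hi]
    · rw [h2, ← hss, ← hsy, hprop i hi]; ring
  simp only [PiLp.inner_apply, RCLike.inner_apply, conj_trivial, hz]
  calc _ = ∑ i, y i₀ / w i₀ * (x i * (H *ᵥ w) i) :=
        Finset.sum_congr rfl fun i _ => by rw [← hfin i]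
    _ = y i₀ / w i₀ * (x ⬝ᵥ H *ᵥ w) := by rw [← Finset.mul_sum]; rfl
    _ = 0 := by rw [hx, mul_zero]

/-- If all slices of a nonnegative symmetric tensor are Lorentzian, then so is its contraction
with a positive vector, provided that the graph of the contraction is a star around `i₀`. -/
theorem isLorentzian_sum_smul (T : ι → Matrix ι ι ℝ) (h0 : ∀ i j k, 0 ≤ T i j k)
    (h12 : ∀ i j k, T i j k = T j i k) (h23 : ∀ i j k, T i j k = T i k j)
    (hT : ∀ i, (T i).IsLorentzian) {w : ι → ℝ} (hw : ∀ i, 0 < w i) (i₀ : ι)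
    (hstar : ∀ i, (∑ q, w q • T q) i i₀ = 0 → ∀ j, (∑ q, w q • T q) i j = 0) :
    (∑ q, w q • T q).IsLorentzian := by
  set H := ∑ q, w q • T q with hHdef
  have hHa : ∀ i j, H i j = ∑ q, w q * T q i j := fun i j => by
    simp [hHdef, Matrix.sum_apply]
  have hH0 : ∀ i j, 0 ≤ H i j := fun i j => by
    rw [hHa]; exact Finset.sum_nonneg fun q _ => mul_nonneg (hw q).le (h0 q i j)
  have hsym : H.IsSymm := by
    ext i j
    rw [transpose_apply, hHa, hHa]
    exact Finset.sum_congr rfl fun q _ => by rw [h23]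
  -- Symmetry of the tensor lets `w` move into a slice, so the Lorentzian inequality of `T q`
  -- against `w` speaks of `H`.
  have hHx : ∀ x q, (H *ᵥ x) q = x ⬝ᵥ T q *ᵥ w := by
    intro x q
    simp only [mulVec, dotProduct, hHa, Finset.sum_mul, Finset.mul_sum]
    refine Finset.sum_congr rfl fun j _ => Finset.sum_congr rfl fun k _ => ?_
    rw [h12 k q j, h23 q k j]; ring
  have hB : ∀ x, x ⬝ᵥ H *ᵥ x ≤ ∑ i, w i * ((H *ᵥ x) i ^ 2 / (H *ᵥ w) i) := by
    intro x
    have e : x ⬝ᵥ H *ᵥ x = ∑ q, w q * (x ⬝ᵥ T q *ᵥ x) := by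
      simp only [hHdef, sum_mulVec, dotProduct_sum, smul_mulVec, dotProduct_smul, smul_eq_mul]
    rw [e]
    refine Finset.sum_le_sum fun q _ => mul_le_mul_of_nonneg_left ?_ (hw q).le
    rw [hHx, hHx]
    have hnn : 0 ≤ w ⬝ᵥ T q *ᵥ w :=
      dotProduct_mulVec_nonneg (h0 q) (fun i => (hw i).le) (fun i => (hw i).le)
    rcases hnn.eq_or_lt with hz | hpos
    · have hTq : T q = 0 := by
        ext i j
        have hterm : ∀ i j, 0 ≤ w i * (T q i j * w j) := fun i j =>
          mul_nonneg (hw i).le (mul_nonneg (h0 q i j) (hw j).le)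
        have hz' : ∑ i, ∑ j, w i * (T q i j * w j) = 0 := by
          rw [hz]; simp only [dotProduct, mulVec, Finset.mul_sum]
        have h1 := (Finset.sum_eq_zero_iff_of_nonneg
          (fun i _ => Finset.sum_nonneg fun k _ => hterm i k)).1 hz' i (Finset.mem_univ i)
        have h2 := (Finset.sum_eq_zero_iff_of_nonneg (fun k _ => hterm i k)).1 h1 j
          (Finset.mem_univ j)
        have h3 := (mul_eq_zero.1 h2).resolve_left (hw i).ne'
        exact (mul_eq_zero.1 h3).resolve_right (hw j).ne'
      simp [hTq]
    · rw [le_div_iff₀ hpos]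
      exact hT q x w fun i => (hw i).le
  exact isLorentzian_of_orthogonal_nonpos hsym hH0 w (nonpos_of_bochner hsym hH0 hw i₀ hstar hB)

end Matrix

/-- The double sum is the sum of squares of the fibre sums; apply Cauchy-Schwarz over the at most
`s.card` nonempty fibres. -/
theorem Finset.sq_sum_le_card_mul_sum_fiber {ι κ : Type*} [DecidableEq κ] (s : Finset ι)
    (f : ι → κ) (x : ι → ℝ) :
    (∑ i ∈ s, x i) ^ 2 ≤ s.card * ∑ i ∈ s, ∑ j ∈ s, if f i = f j then x i * x j else 0 := by
  have e : ∑ i ∈ s, ∑ j ∈ s, (if f i = f j then x i * x j else 0) =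
      ∑ p ∈ s.image f, (∑ i ∈ s with f i = p, x i) ^ 2 := by
    rw [← Finset.sum_fiberwise_of_maps_to (t := s.image f)
      (fun i hi => Finset.mem_image_of_mem f hi)]
    refine Finset.sum_congr rfl fun p _ => ?_
    rw [sq, Finset.sum_mul_sum]
    refine Finset.sum_congr rfl fun i hi => ?_
    rw [Finset.sum_filter]
    refine Finset.sum_congr rfl fun j _ => ?_
    rw [(Finset.mem_filter.1 hi).2]
    simp only [eq_comm]
  rw [e, ← Finset.sum_fiberwise_of_maps_to (t := s.image f)
      (fun i hi => Finset.mem_image_of_mem f hi)]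
  refine sq_sum_le_card_mul_sum_sq.trans (mul_le_mul_of_nonneg_right ?_ ?_)
  · exact_mod_cast Finset.card_image_le
  · exact Finset.sum_nonneg fun _ _ => sq_nonneg _

/-! ### Polynomials as set functions, and the Alexandrov-Fenchel inequality. -/

section SetFunction

variable {β : Type*} [DecidableEq β]

/-- A function `g : Finset β → ℝ` encodes the homogeneous polynomial
`∑ A, g A * w ^ A * t ^ (d - #A) / (d - #A)!`; `partialDeriv` is the partial derivative, where
`none` is the index of the homogenizing variable `t`. -/
def partialDeriv : Option β → (Finset β → ℝ) → Finset β → ℝ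
  | none, g, A => g A
  | some i, g, A => if i ∈ A then 0 else g (insert i A)

theorem partialDeriv_comm (o p : Option β) (g : Finset β → ℝ) :
    partialDeriv o (partialDeriv p g) = partialDeriv p (partialDeriv o g) := by
  funext A
  rcases o with _ | i <;> rcases p with _ | j <;> simp only [partialDeriv]
  by_cases h : i = j
  · subst h; rfl
  · simp only [Finset.mem_insert, h, Ne.symm h, false_or, Finset.insert_comm j i A]
    split_ifs <;> rfl

theorem partialDeriv_nonneg {g : Finset β → ℝ} (hg : ∀ A, 0 ≤ g A) (o : Option β) (A : Finset β) :
    0 ≤ partialDeriv o g A := by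
  rcases o with _ | i <;> simp only [partialDeriv]
  · exact hg A
  · split_ifs
    exacts [le_rfl, hg _]

/-- The matrix of second partial derivatives. -/
def hessian (g : Finset β → ℝ) (A : Finset β) : Matrix (Option β) (Option β) ℝ :=
  Matrix.of fun o p => partialDeriv o (partialDeriv p g) A

theorem hessian_isSymm (g : Finset β → ℝ) (A : Finset β) : (hessian g A).IsSymm := by
  ext o p
  simp only [hessian, Matrix.transpose_apply, Matrix.of_apply, partialDeriv_comm o p]

theorem hessian_nonneg {g : Finset β → ℝ} (hg : ∀ A, 0 ≤ g A) (A : Finset β) (o p : Option β) :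
    0 ≤ hessian g A o p :=
  partialDeriv_nonneg (partialDeriv_nonneg hg p) o A

/-- Nonnegative set functions whose zeros form an upper set. -/
structure IsHereditary (g : Finset β → ℝ) : Prop where
  nonneg : ∀ A, 0 ≤ g A
  eq_zero : ∀ A i, g A = 0 → g (insert i A) = 0

theorem IsHereditary.partialDeriv_eq_zero {g : Finset β → ℝ} (hg : IsHereditary g)
    {A : Finset β} (hA : g A = 0) (o : Option β) : partialDeriv o g A = 0 := by
  rcases o with _ | i <;> simp only [partialDeriv]
  · exact hA
  · split_ifs
    exacts [rfl, hg.eq_zero A i hA]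

/-- Every non-isolated index of the Hessian is adjacent to `none`: this is the connectedness that
the Bochner method needs. -/
theorem IsHereditary.hessian_eq_zero {g : Finset β → ℝ} (hg : IsHereditary g)
    {A : Finset β} {o : Option β} (h : hessian g A o none = 0) (p : Option β) :
    hessian g A o p = 0 := by
  simp only [hessian, Matrix.of_apply] at h ⊢
  rcases o with _ | i <;> simp only [partialDeriv] at h ⊢
  · exact hg.partialDeriv_eq_zero h p
  · split_ifs at h ⊢ with hi
    · rfl
    · exact hg.partialDeriv_eq_zero h p

variable [Fintype β]

/-- The derivative in the direction `v`. -/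
def dirDeriv (v : Option β → ℝ) (g : Finset β → ℝ) : Finset β → ℝ :=
  fun A => ∑ o, v o * partialDeriv o g A

theorem partialDeriv_dirDeriv (p : Option β) (v : Option β → ℝ) (g : Finset β → ℝ) :
    partialDeriv p (dirDeriv v g) = dirDeriv v (partialDeriv p g) := by
  funext A
  rcases p with _ | i
  · rfl
  have h : ∀ f : Finset β → ℝ,
      partialDeriv (some i) f A = if i ∈ A then 0 else f (insert i A) := fun _ => rfl
  simp only [dirDeriv, partialDeriv_comm _ (some i) g, h]
  split_ifs <;> simp

theorem dirDeriv_nonneg {v : Option β → ℝ} (hv : ∀ o, 0 ≤ v o) {g : Finset β → ℝ}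
    (hg : ∀ A, 0 ≤ g A) (A : Finset β) : 0 ≤ dirDeriv v g A :=
  Finset.sum_nonneg fun o _ => mul_nonneg (hv o) (partialDeriv_nonneg hg o A)

theorem hessian_dirDeriv (v : Option β → ℝ) (g : Finset β → ℝ) (A : Finset β) :
    hessian (dirDeriv v g) A = ∑ q, v q • hessian (partialDeriv q g) A := by
  ext o p
  simp only [hessian, Matrix.of_apply, Matrix.sum_apply, Matrix.smul_apply, smul_eq_mul,
    partialDeriv_dirDeriv]
  simp only [dirDeriv]
  refine Finset.sum_congr rfl fun q _ => ?_
  rw [partialDeriv_comm q o, partialDeriv_comm q p]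

theorem dotProduct_hessian_mulVec (g : Finset β → ℝ) (A : Finset β) (x y : Option β → ℝ) :
    x ⬝ᵥ Matrix.mulVec (hessian g A) y = dirDeriv x (dirDeriv y g) A := by
  rw [dirDeriv]
  refine Finset.sum_congr rfl fun o _ => ?_
  rw [partialDeriv_dirDeriv]
  simp only [dirDeriv, Matrix.mulVec, dotProduct, hessian, Matrix.of_apply]
  congr 1
  refine Finset.sum_congr rfl fun p _ => ?_
  rw [partialDeriv_comm o p, mul_comm]

theorem IsHereditary.dirDeriv {g : Finset β → ℝ} (hg : IsHereditary g) {v : Option β → ℝ}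
    (hv : ∀ o, 0 < v o) : IsHereditary (dirDeriv v g) where
  nonneg := dirDeriv_nonneg (fun o => (hv o).le) hg.nonneg
  eq_zero A i hA := by
    have h := (Finset.sum_eq_zero_iff_of_nonneg fun o _ =>
      mul_nonneg (hv o).le (partialDeriv_nonneg hg.nonneg o A)).1 hA none (Finset.mem_univ _)
    have hgA : g A = 0 := (mul_eq_zero.1 h).resolve_left (hv none).ne'
    exact Finset.sum_eq_zero fun o _ => by
      rw [hg.partialDeriv_eq_zero (hg.eq_zero A i hgA), mul_zero]

/-- The inductive step: directional derivatives inherit the Lorentzian property from the partial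
derivatives. -/
theorem hessian_dirDeriv_isLorentzian {g : Finset β → ℝ} (hg : IsHereditary g)
    {v : Option β → ℝ} (hv : ∀ o, 0 < v o) (A : Finset β)
    (hA : (hessian g A).IsLorentzian)
    (hins : ∀ i ∉ A, (hessian g (insert i A)).IsLorentzian) :
    (hessian (dirDeriv v g) A).IsLorentzian := by
  have hstar := fun o => (hg.dirDeriv hv).hessian_eq_zero (A := A) (o := o)
  rw [hessian_dirDeriv] at hstar ⊢
  refine Matrix.isLorentzian_sum_smul _ ?_ ?_ ?_ ?_ hv none hstar
  · exact fun q => hessian_nonneg (partialDeriv_nonneg hg.nonneg q) A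
  · intro i j k
    simp only [hessian, Matrix.of_apply]
    rw [partialDeriv_comm k i, partialDeriv_comm k j, partialDeriv_comm i j]
  · exact fun q i j => (hessian_isSymm _ A).apply j i
  · intro q
    -- Derivatives commute, so slice `q` is the Hessian at `A` if `q = none`, the Hessian at `insert
    -- i A` if `q = some i` with `i ∉ A`, and zero otherwise.
    have h1 : ∀ q, hessian (partialDeriv q g) A = Matrix.of fun o p =>
        partialDeriv q (partialDeriv o (partialDeriv p g)) A := by
      intro q
      ext o p
      simp only [hessian, Matrix.of_apply]
      rw [partialDeriv_comm p q, partialDeriv_comm o q]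
    rw [h1]
    rcases q with _ | i
    · exact hA
    · by_cases hi : i ∈ A
      · simp only [partialDeriv, hi, if_true]
        exact Matrix.isLorentzian_zero
      · simp only [partialDeriv, hi, if_false]
        exact hins i hi

/-- Each new derivative uses Hessians of the previous function at `A` and at sets one larger, so the
degree budget `d` is shared between `A.card` and `l.length`. -/
theorem hessian_foldr_dirDeriv_isLorentzian_of_pos {g : Finset β → ℝ} (hg : IsHereditary g)
    {d : ℕ} (hbase : ∀ A, A.card + 2 ≤ d → (hessian g A).IsLorentzian)
    (l : List (Option β → ℝ)) (hl : ∀ v ∈ l, ∀ o, 0 < v o) :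
    IsHereditary (l.foldr dirDeriv g) ∧
    ∀ A, A.card + l.length + 2 ≤ d → (hessian (l.foldr dirDeriv g) A).IsLorentzian := by
  induction l with
  | nil => exact ⟨hg, hbase⟩
  | cons v l ih =>
    obtain ⟨ih1, ih2⟩ := ih fun u hu => hl u (List.mem_cons_of_mem _ hu)
    have hv := hl v List.mem_cons_self
    refine ⟨ih1.dirDeriv hv, fun A hA => ?_⟩
    rw [List.length_cons] at hA
    refine hessian_dirDeriv_isLorentzian ih1 hv A (ih2 A (by omega)) fun i hi => ih2 _ ?_
    rw [Finset.card_insert_of_notMem hi]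
    omega

theorem continuous_foldr_dirDeriv (g : Finset β → ℝ) (l : List (Option β → ℝ)) (A : Finset β) :
    Continuous fun ε : ℝ => (l.map fun v o => v o + ε).foldr dirDeriv g A := by
  induction l generalizing A with
  | nil => exact continuous_const
  | cons v l ih =>
    simp only [List.map_cons, List.foldr_cons, dirDeriv]
    refine continuous_finsetSum _ fun o _ => (continuous_const.add continuous_id).mul ?_
    rcases o with _ | i <;> simp only [partialDeriv]
    · exact ih A
    · split_ifs
      exacts [continuous_const, ih _]

/-- The Alexandrov-Fenchel inequality for nonnegative directions. -/
theorem dirDeriv_mul_le_sq {g : Finset β → ℝ} (hg : IsHereditary g)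
    {d : ℕ} (hbase : ∀ A, A.card + 2 ≤ d → (hessian g A).IsLorentzian)
    (l : List (Option β → ℝ)) (hl : ∀ v ∈ l, ∀ o, 0 ≤ v o) (hld : l.length + 2 ≤ d)
    (x y : Option β → ℝ) (hy : ∀ o, 0 ≤ y o) :
    dirDeriv x (dirDeriv x (l.foldr dirDeriv g)) ∅ *
      dirDeriv y (dirDeriv y (l.foldr dirDeriv g)) ∅ ≤
      dirDeriv x (dirDeriv y (l.foldr dirDeriv g)) ∅ ^ 2 := by
  -- The inductive step needs strictly positive directions: shift them all by `ε > 0` and let `ε`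
  -- tend to 0.
  have hcont : ∀ u v : Option β → ℝ, Continuous fun ε : ℝ =>
      dirDeriv u (dirDeriv v ((l.map fun v o => v o + ε).foldr dirDeriv g)) ∅ := by
    intro u v
    simp only [← dotProduct_hessian_mulVec, dotProduct, Matrix.mulVec]
    refine continuous_finsetSum _ fun o _ => continuous_const.mul
      (continuous_finsetSum _ fun p _ => Continuous.mul ?_ continuous_const)
    have := continuous_foldr_dirDeriv g l
    rcases o with _ | i <;> rcases p with _ | j <;>
      simp only [hessian, Matrix.of_apply, partialDeriv] <;> (try split_ifs) <;> fun_prop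
  have h0 : (l.map fun v o => v o + (0 : ℝ)) = l := by simp
  have hlim := fun u v => ((hcont u v).tendsto 0).mono_left (nhdsWithin_le_nhds (s := Set.Ioi 0))
  simp only [h0] at hlim
  refine le_of_tendsto_of_tendsto ((hlim x x).mul (hlim y y)) ((hlim x y).pow 2) ?_
  filter_upwards [self_mem_nhdsWithin] with ε hε
  simp only [← dotProduct_hessian_mulVec]
  refine (hessian_foldr_dirDeriv_isLorentzian_of_pos hg hbase _ ?_).2 ∅ (by simpa using hld) x y hy
  intro v hv o
  obtain ⟨u, hu, rfl⟩ := List.mem_map.1 hv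
  exact add_pos_of_nonneg_of_pos (hl u hu o) hε

end SetFunction

/-! ### The quadratic base case for matroids. -/

namespace Matroid

/-- In the contraction by `A`, two nonloops are independent exactly when they are not parallel;
equality of closures is the parallel relation. -/
theorem insert_insert_indep_iff_closure_ne {β : Type*} (M : Matroid β) {A : Set β} (hA : M.Indep A) {i j : β}
    (hi : i ∉ A) (hij : i ≠ j) :
    M.Indep (insert i (insert j A)) ↔ M.Indep (insert i A) ∧ M.Indep (insert j A) ∧
      M.closure (insert i A) ≠ M.closure (insert j A) := by
  constructor
  · intro h
    have hi' : M.Indep (insert i A) := h.subset (Set.insert_subset_insert (Set.subset_insert _ _))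
    have hj' : M.Indep (insert j A) := h.subset (Set.subset_insert _ _)
    refine ⟨hi', hj', fun heq => ?_⟩
    rw [hj'.insert_indep_iff_of_notMem (by simp [hij, hi])] at h
    exact h.2 (heq ▸ M.mem_closure_of_mem' (Set.mem_insert i A) h.1)
  · rintro ⟨hi', hj', hne⟩
    rw [hj'.insert_indep_iff_of_notMem (by simp [hij, hi])]
    rw [hA.insert_indep_iff_of_notMem hi] at hi'
    exact ⟨hi'.1, fun hc => hne (M.closure_insert_congr ⟨hc, hi'.2⟩)⟩

variable {β : Type*} [Fintype β] [DecidableEq β]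

open Classical in
/-- The set function encoding the homogenized independence polynomial of `M`. -/
noncomputable def indepWeight (M : Matroid β) (A : Finset β) : ℝ :=
  if M.Indep (A : Set β) then ((Fintype.card β - A.card).factorial : ℝ) else 0

theorem indepWeight_isHereditary (M : Matroid β) : IsHereditary M.indepWeight where
  nonneg A := by
    unfold indepWeight; split_ifs <;> positivity
  eq_zero A i hA := by
    unfold indepWeight at hA ⊢
    rw [if_neg]
    intro h
    rw [if_pos (h.subset (by simp))] at hA
    exact absurd hA (by positivity)

-- It is enough to test vectors orthogonal to the `t` direction. There the form reduces, up to a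
-- factorial, to `(N + 2) * x none ^ 2 - Q`, where `Q` sums the squares of `x` summed over parallel
-- classes. At most `N + 2` elements lie outside `A`, so Cauchy-Schwarz bounds `Q` below.
open Classical in
theorem hessian_indepWeight_isLorentzian (M : Matroid β) (A : Finset β)
    (hA : A.card + 2 ≤ Fintype.card β) : (hessian M.indepWeight A).IsLorentzian := by
  by_cases hind : M.Indep (A : Set β)
  swap
  · have hz : hessian M.indepWeight A = 0 := by
      have h0 : M.indepWeight A = 0 := by simp [indepWeight, hind]
      ext o p
      refine M.indepWeight_isHereditary.hessian_eq_zero ?_ p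
      rcases o with _ | i
      · exact h0
      · simp only [hessian, Matrix.of_apply, partialDeriv, M.indepWeight_isHereditary.eq_zero A i h0,
          ite_self]
    rw [hz]; exact Matrix.isLorentzian_zero
  obtain ⟨N, hN⟩ := Nat.exists_eq_add_of_le hA
  have hsym := hessian_isSymm M.indepWeight A
  refine Matrix.isLorentzian_of_orthogonal_nonpos hsym
    (hessian_nonneg M.indepWeight_isHereditary.nonneg A) (Pi.single none 1) ?_
  set s : Finset β := {i | i ∉ A ∧ M.Indep (insert i A : Finset β)} with hs
  set cl : β → Set β := fun i => M.closure (insert i A) with hcl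
  set F : ℝ := (N.factorial : ℝ) with hF
  have hF0 : 0 ≤ F := by positivity
  have h00 : hessian M.indepWeight A none none = (N + 2) * (N + 1) * F := by
    simp only [hessian, Matrix.of_apply, partialDeriv, indepWeight, hind, if_true]
    rw [show Fintype.card β - A.card = N + 2 by omega, Nat.factorial_succ, Nat.factorial_succ]
    push_cast; ring
  have hi0 : ∀ i, hessian M.indepWeight A (some i) none = if i ∈ s then (N + 1) * F else 0 := by
    intro i
    simp only [hessian, Matrix.of_apply, partialDeriv, indepWeight, hs, Finset.mem_filter,
      Finset.mem_univ, true_and]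
    by_cases hi : i ∈ A
    · simp [hi]
    · simp only [hi, if_false, not_false_eq_true, true_and]
      refine if_congr Iff.rfl ?_ rfl
      rw [Finset.card_insert_of_notMem hi, show Fintype.card β - (A.card + 1) = N + 1 by omega,
        Nat.factorial_succ]
      push_cast; ring
  have hij : ∀ i j, hessian M.indepWeight A (some i) (some j) =
      if i ∈ s then if j ∈ s then F - (if cl i = cl j then F else 0) else 0 else 0 := by
    intro i j
    simp only [hessian, Matrix.of_apply, partialDeriv, indepWeight, hs, Finset.mem_filter,
      Finset.mem_univ, true_and, Finset.mem_insert]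
    by_cases hi : i ∈ A
    · simp [hi]
    by_cases hj : j ∈ A
    · simp [hi, hj]
    by_cases hne : j = i
    · subst hne; simp
    have hcard : Fintype.card β - (insert j (insert i A)).card = N := by
      rw [Finset.card_insert_of_notMem (by simp [hne, hj]), Finset.card_insert_of_notMem hi]
      omega
    have hiff := M.insert_insert_indep_iff_closure_ne hind (i := j) (j := i)
      (by simpa using hj) hne
    simp only [hi, hj, hne, if_false, false_or, not_false_eq_true, true_and, hcard,
      Finset.coe_insert, hiff, hcl]
    by_cases h1 : M.Indep (insert i (A : Set β)) <;> by_cases h2 : M.Indep (insert j (A : Set β)) <;>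
      by_cases h3 : M.closure (insert i (A : Set β)) = M.closure (insert j (A : Set β)) <;>
      simp [h1, h2, h3, eq_comm, hF]
  intro x hx
  set X : ℝ := ∑ i ∈ s, x (some i) with hX
  set Q : ℝ := ∑ i ∈ s, ∑ j ∈ s, if cl i = cl j then x (some i) * x (some j) else 0 with hQ
  have hXQ : X ^ 2 ≤ (N + 2) * Q := by
    refine (Finset.sq_sum_le_card_mul_sum_fiber s cl fun i => x (some i)).trans ?_
    have hQ0 : 0 ≤ s.card * Q :=
      (sq_nonneg _).trans (Finset.sq_sum_le_card_mul_sum_fiber s cl fun i => x (some i))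
    have hsc : s.card ≤ N + 2 := by
      have : s ⊆ Aᶜ := fun i hi => by
        simp only [hs, Finset.mem_filter] at hi
        simpa using hi.2.1
      have := Finset.card_le_card this
      rw [Finset.card_compl] at this
      omega
    rcases Nat.eq_zero_or_pos s.card with h | h
    · have : s = ∅ := Finset.card_eq_zero.1 h
      simp [this, hQ]
    · have hQ0' : 0 ≤ Q := by
        have : (0 : ℝ) < s.card := by exact_mod_cast h
        exact nonneg_of_mul_nonneg_right hQ0 this
      exact mul_le_mul_of_nonneg_right (by exact_mod_cast hsc) hQ0'
  have hx' : x none * ((N + 2) * (N + 1) * F) + (N + 1) * F * X = 0 := by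
    rw [← hx, Matrix.mulVec_single_one, dotProduct, Fintype.sum_option]
    simp only [Matrix.col_apply, h00, hi0]
    simp [Finset.mul_sum, hX, mul_comm]
  have hval : x ⬝ᵥ Matrix.mulVec (hessian M.indepWeight A) x =
      F * ((N + 2) * (N + 1) * x none ^ 2 + 2 * (N + 1) * (x none * X) + X ^ 2 - Q) := by
    have e1 : ∀ j, hessian M.indepWeight A none (some j) = if j ∈ s then (N + 1) * F else 0 :=
      fun j => by rw [← hi0, hsym.apply]
    have e2 : ∑ j, (if j ∈ s then (N + 1) * F else 0) * x (some j) = (N + 1) * F * X := by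
      simp [Finset.mul_sum, hX]
    have e3 : ∀ i, x (some i) * ((if i ∈ s then (N + 1) * F else 0) * x none +
        ∑ j, (if i ∈ s then if j ∈ s then F - (if cl i = cl j then F else 0) else 0 else 0) *
          x (some j)) = if i ∈ s then (N + 1) * F * x none * x (some i) + (F * x (some i) * X -
            F * ∑ j ∈ s, if cl i = cl j then x (some i) * x (some j) else 0) else 0 := by
      intro i
      by_cases hi : i ∈ s
      · simp only [hi, if_true, ite_mul, zero_mul, Finset.sum_ite_mem, Finset.univ_inter, mul_add,
          Finset.mul_sum, hX, ← Finset.sum_sub_distrib]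
        congr 1
        · ring
        · refine Finset.sum_congr rfl fun j _ => ?_
          split_ifs <;> ring
      · simp [hi]
    simp only [dotProduct, Matrix.mulVec, Fintype.sum_option, h00, hi0, hij, e1, e2, e3,
      Finset.sum_ite_mem, Finset.univ_inter, Finset.sum_add_distrib, Finset.sum_sub_distrib,
      ← Finset.mul_sum, ← Finset.sum_mul]
    rw [← hX, ← hQ]; ring
  rw [hval]
  rcases hF0.eq_or_lt with h | hFpos
  · rw [← h, zero_mul]
  refine mul_nonpos_of_nonneg_of_nonpos hF0 ?_
  -- The orthogonality condition, solved for `X`.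
  have hX' : X = -((N + 2) * x none) := by
    have : (N + 1) * F * ((N + 2) * x none + X) = 0 := by rw [← hx']; ring
    have := (mul_eq_zero.1 this).resolve_left (by positivity)
    linarith
  rw [hX'] at hXQ ⊢
  have hN2 : (0 : ℝ) < N + 2 := by positivity
  have : (N + 2) * x none ^ 2 ≤ Q := by
    refine le_of_mul_le_mul_left ?_ hN2
    nlinarith
  nlinarith

end Matroid

/-! ### Iterated derivatives along colour classes. -/

section ColoredDerivative

variable {β κ : Type*} [Fintype β] [DecidableEq β] [Fintype κ] [DecidableEq κ]

/-- The indicator vector of a colour class. -/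
def colorIndicator (col : β → κ) (o : κ) : Option β → ℝ
  | none => 0
  | some x => if col x = o then 1 else 0

/-- The coefficient of `h B` in the value at `A` of the iterated derivative of `h` with `c o`
derivatives in the direction of each colour class `o`. -/
def colorKernel (col : β → κ) (c : κ → ℕ) (A B : Finset β) : ℕ :=
  if A ⊆ B ∧ ∀ o, (Finset.card {x ∈ B \ A | col x = o}) = c o then ∏ o, (c o).factorial else 0

/-- The iterated derivative of `h` with `c o` derivatives in the direction of each colour class
`o`. -/
def colorDeriv (col : β → κ) (c : κ → ℕ) (h : Finset β → ℝ) (A : Finset β) : ℝ :=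
  ∑ B, (colorKernel col c A B : ℝ) * h B

omit [Fintype β] in
theorem colorKernel_insert (col : β → κ) (c : κ → ℕ) {A B : Finset β} (hAB : A ⊆ B) {x : β}
    (hx : x ∈ B \ A) :
    colorKernel col c (insert x A) B =
      if ∀ o, (Finset.card {x ∈ B \ A | col x = o}) = (c + Pi.single (col x) 1 : κ → ℕ) o
      then ∏ o, (c o).factorial else 0 := by
  have hxB := (Finset.mem_sdiff.1 hx).1
  unfold colorKernel
  refine if_congr ?_ rfl rfl
  rw [and_iff_right (Finset.insert_subset hxB hAB), Finset.sdiff_insert]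
  refine forall_congr' fun o => ?_
  rw [Finset.filter_erase, Pi.add_apply]
  by_cases h : col x = o
  · subst h
    have hmem : x ∈ Finset.filter (fun y => col y = col x) (B \ A) := by simpa using hx
    rw [Pi.single_eq_same, ← Finset.card_erase_add_one hmem, Nat.add_right_cancel_iff]
  · rw [Finset.erase_eq_of_notMem (by simp [h]), Pi.single_eq_of_ne (Ne.symm h), add_zero]

theorem prod_factorial_add_single {κ : Type*} [Fintype κ] [DecidableEq κ] (c : κ → ℕ) (o : κ) :
    ∏ p, ((c + Pi.single o 1 : κ → ℕ) p).factorial = (c o + 1) * ∏ p, (c p).factorial := by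
  rw [← Finset.mul_prod_erase _ _ (Finset.mem_univ o),
    ← Finset.mul_prod_erase _ (fun p => (c p).factorial) (Finset.mem_univ o), ← mul_assoc]
  congr 1
  · simp [Nat.factorial_succ]
  · refine Finset.prod_congr rfl fun p hp => ?_
    simp [Finset.ne_of_mem_erase hp]

/-- The element differentiated last may be any of the `c o + 1` elements of colour `o` in `B \ A`,
which turns `(c o)!` into `(c o + 1)!`. -/
theorem sum_colorKernel_insert (col : β → κ) (c : κ → ℕ) (o : κ) (A B : Finset β) :
    ∑ x, (if col x = o then if x ∈ A then 0 else colorKernel col c (insert x A) B else 0) =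
      colorKernel col (c + Pi.single o 1) A B := by
  by_cases hAB : A ⊆ B
  swap
  · have h1 : ∀ x, ¬ insert x A ⊆ B := fun x h => hAB ((Finset.subset_insert x A).trans h)
    simp [colorKernel, hAB, h1]
  have h1 : ∀ x, (if col x = o then if x ∈ A then 0 else colorKernel col c (insert x A) B else 0) =
      if x ∈ Finset.filter (fun x => col x = o) (B \ A) then
        (if ∀ p, (Finset.card {x ∈ B \ A | col x = p}) = (c + Pi.single o 1 : κ → ℕ) p
          then ∏ p, (c p).factorial else 0) else 0 := by
    intro x
    by_cases hc : col x = o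
    swap
    · simp [hc]
    by_cases hA : x ∈ A
    · simp [hA]
    by_cases hB : x ∈ B
    · have hx : x ∈ B \ A := Finset.mem_sdiff.2 ⟨hB, hA⟩
      rw [if_pos hc, if_neg hA, if_pos (Finset.mem_filter.2 ⟨hx, hc⟩),
        colorKernel_insert col c hAB hx, hc]
    · have h2 : ¬ insert x A ⊆ B := fun h => hB (h (Finset.mem_insert_self x A))
      simp [colorKernel, hB, h2]
  rw [Finset.sum_congr rfl fun x _ => h1 x, Finset.sum_ite_mem, Finset.univ_inter,
    Finset.sum_const, smul_eq_mul, colorKernel]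
  simp only [hAB, true_and]
  split_ifs with h
  · rw [h o, prod_factorial_add_single]; simp
  · simp

theorem dirDeriv_colorIndicator (col : β → κ) (c : κ → ℕ) (o : κ) (h : Finset β → ℝ) :
    dirDeriv (colorIndicator col o) (colorDeriv col c h) =
      colorDeriv col (c + Pi.single o 1) h := by
  funext A
  simp only [dirDeriv, Fintype.sum_option, colorIndicator, zero_mul, zero_add, partialDeriv,
    colorDeriv, ← sum_colorKernel_insert, Nat.cast_sum, Finset.sum_mul]
  rw [Finset.sum_comm]
  refine Finset.sum_congr rfl fun x _ => ?_
  split_ifs <;> simp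

theorem colorDeriv_zero (col : β → κ) (h : Finset β → ℝ) : colorDeriv col 0 h = h := by
  funext A
  rw [colorDeriv, Finset.sum_eq_single A]
  · simp [colorKernel]
  · intro B _ hBA
    rw [colorKernel, if_neg, Nat.cast_zero, zero_mul]
    rintro ⟨hAB, h0⟩
    refine hBA (Finset.Subset.antisymm (fun x hx => ?_) hAB)
    by_contra hxA
    have h1 := Finset.card_eq_zero.1 (h0 (col x))
    exact Finset.notMem_empty x (h1 ▸ by simp [hx, hxA])
  · simp

theorem exists_colorDeriv_eq_foldr (col : β → κ) (h : Finset β → ℝ) (c : κ → ℕ) :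
    ∃ l : List (Option β → ℝ), (∀ v ∈ l, ∀ o, 0 ≤ v o) ∧ l.length = ∑ o, c o ∧
      colorDeriv col c h = l.foldr dirDeriv h := by
  induction hn : ∑ o, c o generalizing c with
  | zero =>
    have hc : c = 0 := funext fun o => Finset.sum_eq_zero_iff.1 hn o (Finset.mem_univ o)
    exact ⟨[], by simp, rfl, by rw [hc, colorDeriv_zero]; rfl⟩
  | succ n ih =>
    obtain ⟨o, -, ho⟩ := Finset.exists_ne_zero_of_sum_ne_zero (hn.trans_ne n.succ_ne_zero)
    obtain ⟨c', rfl⟩ : ∃ c' : κ → ℕ, c = c' + Pi.single o 1 := by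
      refine ⟨c - Pi.single o 1, funext fun p => ?_⟩
      by_cases hp : p = o
      · subst hp
        simpa using (Nat.sub_add_cancel (Nat.one_le_iff_ne_zero.2 ho)).symm
      · simp [hp]
    obtain ⟨l, hl, hlen, hfold⟩ := ih c' (by
      simpa [Finset.sum_add_distrib] using hn)
    refine ⟨colorIndicator col o :: l, ?_, by rw [List.length_cons, hlen], ?_⟩
    · intro v hv
      rcases List.mem_cons.1 hv with rfl | hv
      · rintro (_ | x) <;> simp only [colorIndicator]
        · exact le_rfl
        · split_ifs <;> norm_num
      · exact hl v hv
    · rw [List.foldr_cons, ← hfold, dirDeriv_colorIndicator]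

end ColoredDerivative

/-! ### Mason's inequality for coloured independent sets. -/

namespace Matroid

variable {β κ : Type*} [Fintype β] [DecidableEq β] [Fintype κ] [DecidableEq κ]

open Classical in
/-- The independent sets with `c o` elements of each colour `o`. -/
noncomputable def coloredIndep (M : Matroid β) (col : β → κ) (c : κ → ℕ) : Finset (Finset β) :=
  {B | M.Indep (B : Set β) ∧ ∀ o, (Finset.card {x ∈ B | col x = o}) = c o}

theorem colorDeriv_indepWeight (M : Matroid β) (col : β → κ) (c : κ → ℕ) :
    colorDeriv col c M.indepWeight ∅ = (∏ o, (c o).factorial : ℕ) *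
      (Fintype.card β - ∑ o, c o).factorial * (M.coloredIndep col c).card := by
  classical
  rw [Finset.card_eq_sum_ones, Nat.cast_sum, Finset.mul_sum,
    ← Finset.univ_inter (M.coloredIndep col c), ← Finset.sum_ite_mem, colorDeriv]
  refine Finset.sum_congr rfl fun B _ => ?_
  simp only [coloredIndep, Finset.mem_filter, Finset.mem_univ, colorKernel, indepWeight,
    Finset.empty_subset, true_and, Finset.sdiff_empty]
  by_cases h1 : M.Indep (B : Set β)
  swap
  · simp [h1]
  by_cases h2 : ∀ o, (Finset.card {x ∈ B | col x = o}) = c o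
  · have h3 : B.card = ∑ o, c o := by
      rw [Finset.card_eq_sum_card_fiberwise (t := Finset.univ) fun x _ => Finset.mem_univ (col x)]
      exact Finset.sum_congr rfl fun o _ => h2 o
    simp [h1, h2, h3]
  · simp [h2]

/-- Alexandrov-Fenchel for the indicator of colour `o` against the variable `t`, whose derivative is
the identity on set functions. Cancelling common factorials leaves the stated factors. -/
theorem coloredIndep_mason (M : Matroid β) (col : β → κ) (c : κ → ℕ) (o : κ) (t : ℕ)
    (ht : ∑ p, c p + t + 2 = Fintype.card β) :
    ((c o : ℝ) + 2) * (t + 2) * (M.coloredIndep col (c + Pi.single o 1 + Pi.single o 1)).card *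
        (M.coloredIndep col c).card ≤
      (c o + 1) * (t + 1) * ((M.coloredIndep col (c + Pi.single o 1)).card : ℝ) ^ 2 := by
  obtain ⟨l, hl, hlen, hfold⟩ := exists_colorDeriv_eq_foldr col M.indepWeight c
  have hone : ∀ g : Finset β → ℝ, dirDeriv (Pi.single none 1) g = g := fun g => by
    funext A
    simp [dirDeriv, Fintype.sum_option, partialDeriv]
  have key := dirDeriv_mul_le_sq M.indepWeight_isHereditary M.hessian_indepWeight_isLorentzian
    l hl (by omega) (colorIndicator col o) (Pi.single none 1)
    (fun p => by by_cases hp : p = none <;> simp [hp])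
  rw [← hfold, hone, hone, dirDeriv_colorIndicator, dirDeriv_colorIndicator,
    colorDeriv_indepWeight, colorDeriv_indepWeight, colorDeriv_indepWeight,
    prod_factorial_add_single, prod_factorial_add_single] at key
  simp only [Pi.add_apply, Finset.sum_add_distrib, Pi.single_eq_same, Finset.sum_pi_single',
    Finset.mem_univ, if_true] at key
  rw [show Fintype.card β - ∑ p, c p = t + 1 + 1 by omega,
    show Fintype.card β - (∑ p, c p + 1) = t + 1 by omega,
    show Fintype.card β - (∑ p, c p + 1 + 1) = t by omega, Nat.factorial_succ (t + 1),
    Nat.factorial_succ t] at key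
  push_cast at key
  have hpos : (0 : ℝ) <
      (c o + 1) * (t + 1) * ((∏ p, ((c p).factorial : ℝ)) * (t.factorial : ℝ)) ^ 2 := by
    have : (0 : ℝ) < ∏ p, ((c p).factorial : ℝ) :=
      Finset.prod_pos fun p _ => by exact_mod_cast (c p).factorial_pos
    positivity
  refine le_of_mul_le_mul_left ?_ hpos
  refine le_trans (le_of_eq ?_) (key.trans (le_of_eq ?_)) <;> ring

end Matroid

/-! ### Transfer to the original counts. -/

/-- Passing to the subtype `M.E` makes the number of variables the size of the ground set; colour
`none` stands for `R`. -/
theorem indepCount_eq_card_coloredIndep {α : Type*} {k : ℕ} (M : Matroid α) [Fintype M.E]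
    (S : Fin k → Set α)
    (col : M.E → Option (Fin k)) (hcol : ∀ x i, col x = some i ↔ (x : α) ∈ S i)
    (c : Fin k → ℕ) (a : ℕ) :
    indepCount M S c a = ((M.comap ((↑) : M.E → α)).coloredIndep col
      fun o => o.elim a c).card := by
  classical
  have hinj : Function.Injective fun B : Finset M.E => ((↑) : M.E → α) '' (B : Set M.E) :=
    (Set.image_injective.2 Subtype.val_injective).comp Finset.coe_injective
  have hcount : ∀ (B : Finset M.E) (T : Set α) (o : Option (Fin k)),
      (∀ x : M.E, col x = o ↔ (x : α) ∈ T) →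
      (((↑) : M.E → α) '' (B : Set M.E) ∩ T).ncard = Finset.card {x ∈ B | col x = o} := by
    intro B T o h
    rw [← Set.ncard_coe_finset, ← Set.ncard_image_of_injective _ Subtype.val_injective,
      ← Set.image_inter_preimage]
    congr 2
    ext x
    simp [h]
  have hnone : ∀ x : M.E, col x = none ↔ (x : α) ∈ M.E \ ⋃ i, S i := by
    intro x
    simp only [Set.mem_sdiff, x.2, true_and, Set.mem_iUnion, ← hcol, Option.eq_none_iff_forall_ne_some]
    simp
  rw [indepCount, ← Set.ncard_coe_finset, ← Set.ncard_image_of_injective _ hinj]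
  congr 1
  ext A
  simp only [indepFamily, Matroid.coloredIndep, Set.mem_image, Finset.coe_filter, Finset.mem_univ,
    true_and, Set.mem_ofPred_eq, Matroid.comap_indep_iff, Option.forall]
  constructor
  · rintro ⟨hA, h1, h2⟩
    have hB : ((↑) : M.E → α) '' (((↑) : M.E → α) ⁻¹' A) = A := by
      rw [Subtype.image_preimage_coe, Set.inter_eq_right.2 hA.subset_ground]
    refine ⟨(((↑) : M.E → α) ⁻¹' A).toFinset, ⟨⟨?_, Subtype.val_injective.injOn⟩, ?_, fun i => ?_⟩, ?_⟩
    · simpa [hB] using hA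
    · rw [← hcount _ _ _ hnone]; simpa [hB] using h1
    · rw [← hcount _ _ _ (hcol · i)]; simpa [hB] using h2 i
    · simp [hB]
  · rintro ⟨B, ⟨⟨hB, -⟩, h1, h2⟩, rfl⟩
    exact ⟨hB, (hcount _ _ _ hnone).trans h1, fun i => (hcount _ _ _ (hcol · i)).trans (h2 i)⟩

theorem theorem14p1 {α : Type*} (M : Matroid α) [M.Finite] (n r : ℕ)
    (hn : M.E.ncard = n) (hr : M.eRank = r)
    (k : ℕ) (S : Fin k → Set α) (hS : ∀ i, S i ⊆ M.E)
    (hdisj : Pairwise fun i j => Disjoint (S i) (S j))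
    (c : Fin k → ℕ) (hc : ∀ i, c i ≤ r)
    (m : ℤ) (hm : m = (n : ℤ) - ∑ i, (c i : ℤ))
    (a : ℕ) (ha : 1 ≤ a) (ham : (a : ℤ) ≤ min ((r : ℤ) - 1) (m - 1)) :
    (1 + 1 / (a : ℝ)) * (1 + 1 / ((m : ℝ) - (a : ℝ))) *
        (indepCount M S c (a + 1) : ℝ) * (indepCount M S c (a - 1) : ℝ) ≤
      (indepCount M S c a : ℝ) ^ 2 := by
  classical
  let _ := M.ground_finite.fintype
  have hcard : Fintype.card M.E = n := by rw [← hn, Set.ncard_eq_toFinset_card', Set.toFinset_card]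
  set col : M.E → Option (Fin k) := fun x => if h : ∃ i, (x : α) ∈ S i then some h.choose else none
    with hcoldef
  have hcol : ∀ x i, col x = some i ↔ (x : α) ∈ S i := by
    intro x i
    simp only [hcoldef]
    constructor
    · intro h
      split_ifs at h with hx
      exact Option.some.inj h ▸ hx.choose_spec
    · intro h
      have hx : ∃ i, (x : α) ∈ S i := ⟨i, h⟩
      rw [dif_pos hx]
      congr 1
      by_contra hne
      exact Set.disjoint_left.1 (hdisj hne) hx.choose_spec h
  obtain ⟨b, rfl⟩ := Nat.exists_eq_add_of_le' ha
  have hmb := ham.trans (min_le_right _ _)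
  -- Here `b = a - 1` and `t = m - a - 1`, a natural number because `a ≤ m - 1`.
  obtain ⟨t, ht⟩ : ∃ t : ℕ, ∑ i, c i + b + t + 2 = n := by
    refine ⟨n - (∑ i, c i + b + 2), ?_⟩
    rw [hm] at hmb
    push_cast at hmb
    zify
    rw [Nat.cast_sub]
    · push_cast; ring
    · zify; linarith
  have hadd : ∀ p : ℕ, (fun o : Option (Fin k) => o.elim (p + 1) c) =
      (fun o => o.elim p c) + Pi.single none 1 := by
    intro p; funext o
    rcases o with _ | i <;> simp
  have key := (M.comap ((↑) : M.E → α)).coloredIndep_mason col (fun o => o.elim b c) none t (by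
    rw [hcard, Fintype.sum_option, ← ht]
    simp only [Option.elim]
    ring)
  rw [← hadd, ← hadd] at key
  simp only [← indepCount_eq_card_coloredIndep M S col hcol, Option.elim_none] at key
  rw [Nat.add_sub_cancel]
  have hmt : (m : ℝ) - ((b + 1 : ℕ) : ℝ) = t + 1 := by
    have : m = t + b + 2 := by
      rw [hm, ← ht]; push_cast; ring
    rw [this]; push_cast; ring
  rw [hmt]
  push_cast
  have hb : (0 : ℝ) < b + 1 := by positivity
  have htp : (0 : ℝ) < t + 1 := by positivity
  have e : (1 + 1 / ((b : ℝ) + 1)) * (1 + 1 / ((t : ℝ) + 1)) =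
      (b + 2) * (t + 2) / ((b + 1) * (t + 1)) := by
    field_simp
    ring
  rw [e, div_mul_eq_mul_div, div_mul_eq_mul_div, div_le_iff₀ (by positivity)]
  linarith
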